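/- All monoids are abelian and written additively. On a monoid $M$ write $x\le y$ if $x+z=y$ for some $z\in M$. The monoid $M$ is \emph{conical} if $x+y=0$ implies $x=y=0$. It is a \emph{refinement monoid} if whenever $a_1+a_2=b_1+b_2$ in $M$ there are $z_{ij}\in M$ ($i,j\in\{1,2\}$) with $a_i=z_{1i}+z_{2i}$ and $b_i=z_{i1}+z_{i2}$ for $i=1,2$. An element $u\ne 0$ is an \emph{order unit} if for every $x\in M$ there is $n\in\mathbb{N}$ with $x\le nu$, and $M$ is \emph{simple} if every non-zero element is an order unit. A non-zero element $x$ is \emph{infinite} if $x=x+y$ for some $y\neq 0$, \emph{finite} if it is not infinite, and \emph{properly infinite} if $2x\le x$. A sequence $(x_n)_{n\ge1}$ in $M$ is \emph{full} if $x_n\le x_{n+1}$ for all $n$ and for every $y\in M$ there are $n,m\in\mathbb{N}$ with $y\le m x_n$. A conical monoid $M$ has the \emph{Corona Factorization Property} (CFP) if for every full sequence $(x_n)_{n\ge1}$ in $M$, every sequence $(y_n)_{n\ge1}$ in $M$ and every natural number $m$ such that $x_n\le m y_n$ for all $n$, there is $k\ge 1$ with $x_1\le y_1+y_2+\cdots+y_k$.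 \textbf{Proposition.} There exists a simple conical refinement monoid $M$ with an order unit $u$ such that $u$ is finite while $2u$ is properly infinite. In particular, $M$ does not have the CFP. -/

import Mathlib

namespace RefMonoid

variable {M : Type*} [AddCommMonoid M]

/-- The algebraic preorder of a commutative monoid: `x ≤ y` iff `x + z = y` for some `z`. -/
def AlgLE (x y : M) : Prop := ∃ z : M, x + z = y

/-- `u` is an order unit: `u ≠ 0` and every element lies below a multiple of `u`. -/
def IsOrderUnit (u : M) : Prop := u ≠ 0 ∧ ∀ x : M, ∃ n : ℕ, AlgLE x (n • u)

/-- `x` is infinite: `x ≠ 0` and `x = x + y` for some `y ≠ 0`. -/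
def IsInfinite (x : M) : Prop := x ≠ 0 ∧ ∃ y : M, y ≠ 0 ∧ x = x + y

/-- `x` is properly infinite: `x ≠ 0` and `2x ≤ x`. -/
def IsProperlyInfinite (x : M) : Prop := x ≠ 0 ∧ AlgLE (2 • x) x

/-- A sequence is full if it is increasing (in the weak sense) for the algebraic preorder and
every element lies below a multiple of some term. -/
def IsFullSeq (x : ℕ → M) : Prop :=
  (∀ n : ℕ, AlgLE (x n) (x (n + 1))) ∧ ∀ y : M, ∃ n m : ℕ, AlgLE y (m • x n)

variable (M)

/-- `M` is conical: `x + y = 0` only when `x = y = 0`. -/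
def IsConical : Prop := ∀ x y : M, x + y = 0 → x = 0 ∧ y = 0

/-- `M` is simple: every non-zero element is an order unit. -/
def IsSimple : Prop := ∀ u : M, u ≠ 0 → IsOrderUnit u

/-- `M` is a refinement monoid: every equation `a₁ + a₂ = b₁ + b₂` has a refinement. -/
def IsRefinement : Prop :=
  ∀ a₁ a₂ b₁ b₂ : M, a₁ + a₂ = b₁ + b₂ →
    ∃ z₁₁ z₁₂ z₂₁ z₂₂ : M,
      a₁ = z₁₁ + z₂₁ ∧ a₂ = z₁₂ + z₂₂ ∧ b₁ = z₁₁ + z₁₂ ∧ b₂ = z₂₁ + z₂₂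

/-- The Corona Factorization Property of a (conical) monoid. Sequences are indexed from `0`, so
that the first term is `x 0` and `y 0 + ⋯ + y k` is a partial sum with at least one term. -/
def HasCFP : Prop :=
  ∀ x y : ℕ → M, IsFullSeq x → ∀ m : ℕ,
    (∀ n : ℕ, AlgLE (x n) (m • y n)) →
      ∃ k : ℕ, AlgLE (x 0) (∑ i ∈ Finset.range (k + 1), y i)

end RefMonoid

/-! Work with monoids having an absorbing element `top` such that every non-zero element has a
multiple equal to `top`. They are simple, and their only infinite element is `top`
(`eq_top_of_infinite`), so any u ≠ `top` with 2u = `top` is finite with 2u properly infinite. In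
`base`, the singletons double to `top` while sums of distinct ones never reach it, which also
refutes the CFP (`not_hasCFP`).

It remains to embed `base` in a refinement monoid of this kind. For each equation between non-zero
elements of M, add four formal matrix entries. A family of matrices built from full rows and columns
has a well-defined value in M; every other family is valued at `top`. The quotient by the syntactic
congruence of this valuation contains M (`incl_injective`) and refines its equations
(`exists_refinement_incl`). Iterating and passing to the limit gives refinement. -/

/-- Two elements are related when no translate of them is separated by `Φ`. -/
def syntacticCon {X Y : Type} [AddCommMonoid X] (Φ : X → Y) : AddCon X where
  r x y := ∀ w, Φ (x + w) = Φ (y + w)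
  iseqv := ⟨fun _ _ => rfl, fun h w => (h w).symm, fun h h' w => (h w).trans (h' w)⟩
  add' := by
    intro x y x' y' h h' w
    rw [add_assoc, h, add_left_comm, h', add_left_comm, add_assoc]

/-- A non-trivial conical monoid with an absorbing element `top`, such that every non-zero element
has a multiple equal to `top`. -/
structure AbsorbingMonoid where
  carrier : Type
  [inst : AddCommMonoid carrier]
  top : carrier
  top_ne : top ≠ 0
  top_add : ∀ x, top + x = top
  conical : RefMonoid.IsConical carrier
  exists_nsmul : ∀ x, x ≠ 0 → ∃ n : ℕ, n • x = top

namespace AbsorbingMonoid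

instance (M : AbsorbingMonoid) : AddCommMonoid M.carrier := M.inst

/-- The quotient by a syntactic congruence, as an absorbing monoid. -/
def ofMap {X Y : Type} [AddCommMonoid X] (Φ : X → Y) (t : X) (ht : Φ t ≠ Φ 0)
    (htop : ∀ w, Φ (t + w) = Φ t) (hcon : ∀ x y, Φ (x + y) = Φ 0 → x = 0 ∧ y = 0)
    (hnil : ∀ x, x ≠ 0 → ∃ n : ℕ, ∀ w, Φ (n • x + w) = Φ t) : AbsorbingMonoid where
  carrier := (syntacticCon Φ).Quotient
  top := (t : (syntacticCon Φ).Quotient)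
  top_ne := by
    intro h
    have := (AddCon.eq _).1 h 0
    simp only [add_zero] at this
    exact ht this
  top_add := by
    intro x
    induction x using AddCon.induction_on with
    | H x =>
      rw [← AddCon.coe_add]
      refine (AddCon.eq _).2 fun w => ?_
      rw [add_assoc, htop, htop]
  conical := by
    intro x y h
    induction x using AddCon.induction_on with
    | H x =>
    induction y using AddCon.induction_on with
    | H y =>
      rw [← AddCon.coe_add] at h
      have := (AddCon.eq _).1 h 0
      simp only [add_zero] at this
      obtain ⟨rfl, rfl⟩ := hcon x y this
      exact ⟨rfl, rfl⟩
  exists_nsmul := by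
    intro x hx
    induction x using AddCon.induction_on with
    | H x =>
      obtain ⟨n, hn⟩ := hnil x (by rintro rfl; exact hx rfl)
      refine ⟨n, ?_⟩
      refine (map_nsmul (syntacticCon Φ).mk' n x).symm.trans ((AddCon.eq _).2 fun w => ?_)
      rw [hn, htop]

theorem add_top (M : AbsorbingMonoid) (x : M.carrier) : x + M.top = M.top := by
  rw [add_comm, M.top_add]

theorem nsmul_eq_zero (M : AbsorbingMonoid) {x : M.carrier} (hx : x ≠ 0) {n : ℕ}
    (h : n • x = 0) : n = 0 := by
  cases n with
  | zero => rfl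
  | succ n =>
    rw [succ_nsmul] at h
    exact absurd (M.conical _ _ h).2 hx

theorem nsmul_eq_top_of_le (M : AbsorbingMonoid) {x : M.carrier} {m n : ℕ} (h : m • x = M.top)
    (hmn : m ≤ n) : n • x = M.top := by
  obtain ⟨k, rfl⟩ := Nat.exists_eq_add_of_le hmn
  rw [add_nsmul, h, M.top_add]

/-! ### Adjoining refinements -/

/-- An equation `a₀ + a₁ = b₀ + b₁` between non-zero elements. -/
structure Equation (M : AbsorbingMonoid) where
  a₀ : M.carrier
  a₁ : M.carrier
  b₀ : M.carrier
  b₁ : M.carrier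
  eq : a₀ + a₁ = b₀ + b₁
  ha₀ : a₀ ≠ 0
  ha₁ : a₁ ≠ 0
  hb₀ : b₀ ≠ 0
  hb₁ : b₁ ≠ 0

/-- Multiplicities of the two rows and two columns of a matrix, or its four entries. -/
abbrev Quad : Type := ℕ × ℕ × ℕ × ℕ

/-- The `2 × 2` matrix that is a given combination of full rows and full columns. -/
def matrixOf : Quad →+ Quad where
  toFun c := (c.1 + c.2.2.1, c.1 + c.2.2.2, c.2.1 + c.2.2.1, c.2.1 + c.2.2.2)
  map_zero' := rfl
  map_add' x y := by
    simp only [Prod.fst_add, Prod.snd_add, Prod.mk_add_mk, Prod.mk.injEq]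
    omega

theorem mem_range_matrixOf (f : Quad) :
    (∃ c, matrixOf c = f) ↔ f.1 + f.2.2.2 = f.2.1 + f.2.2.1 := by
  obtain ⟨p, q, r, s⟩ := f
  constructor
  · rintro ⟨c, hc⟩
    simp only [matrixOf, AddMonoidHom.coe_mk, ZeroHom.coe_mk, Prod.mk.injEq] at hc
    simp only
    omega
  · intro h
    simp only at h
    -- Remove the first column as often as possible; one row then has a zero first entry, and the
    -- balance condition fixes the rest.
    refine ⟨(p - min p r, r - min p r, min p r, q - (p - min p r)), ?_⟩
    simp only [matrixOf, AddMonoidHom.coe_mk, ZeroHom.coe_mk, Prod.mk.injEq]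
    omega

namespace Equation

variable {M : AbsorbingMonoid} (e : M.Equation)

/-- The value of a combination of rows and columns. -/
def value : Quad →+ M.carrier where
  toFun c := c.1 • e.a₀ + c.2.1 • e.a₁ + c.2.2.1 • e.b₀ + c.2.2.2 • e.b₁
  map_zero' := by simp
  map_add' x y := by
    simp only [Prod.fst_add, Prod.snd_add, add_nsmul]
    abel

theorem value_apply (c : Quad) :
    e.value c = c.1 • e.a₀ + c.2.1 • e.a₁ + c.2.2.1 • e.b₀ + c.2.2.2 • e.b₁ := rfl

theorem value_shift (d p q r s : ℕ) :
    e.value (p + d, q + d, r, s) = e.value (p, q, r + d, s + d) := by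
  have h : d • e.a₀ + d • e.a₁ = d • e.b₀ + d • e.b₁ := by
    rw [← nsmul_add, e.eq, nsmul_add]
  simp only [value_apply, add_nsmul]
  calc _ = p • e.a₀ + q • e.a₁ + r • e.b₀ + s • e.b₁ + (d • e.a₀ + d • e.a₁) := by abel
    _ = _ := by rw [h]; abel

/-- The only relation between rows and columns is that both rows sum to the same matrix as both
columns, and `e.eq` is that relation in M. -/
theorem value_congr {c c' : Quad} (h : matrixOf c = matrixOf c') : e.value c = e.value c' := by
  obtain ⟨p, q, r, s⟩ := c
  obtain ⟨p', q', r', s'⟩ := c'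
  simp only [matrixOf, AddMonoidHom.coe_mk, ZeroHom.coe_mk, Prod.mk.injEq] at h
  obtain ⟨h₁, h₂, h₃, h₄⟩ := h
  rcases le_total p p' with hp | hp
  · obtain ⟨d, rfl⟩ := Nat.exists_eq_add_of_le hp
    obtain rfl : q' = q + d := by omega
    obtain rfl : r = r' + d := by omega
    obtain rfl : s = s' + d := by omega
    exact (e.value_shift d _ _ _ _).symm
  · obtain ⟨d, rfl⟩ := Nat.exists_eq_add_of_le hp
    obtain rfl : q = q' + d := by omega
    obtain rfl : r' = r + d := by omega
    obtain rfl : s' = s + d := by omega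
    exact e.value_shift d _ _ _ _

theorem value_eq_zero {c : Quad} (h : e.value c = 0) : c = 0 := by
  rw [value_apply] at h
  obtain ⟨h, h₄⟩ := M.conical _ _ h
  obtain ⟨h, h₃⟩ := M.conical _ _ h
  obtain ⟨h₁, h₂⟩ := M.conical _ _ h
  exact Prod.ext (M.nsmul_eq_zero e.ha₀ h₁) (Prod.ext (M.nsmul_eq_zero e.ha₁ h₂)
    (Prod.ext (M.nsmul_eq_zero e.hb₀ h₃) (M.nsmul_eq_zero e.hb₁ h₄)))

theorem exists_value_eq_top : ∃ N : ℕ, ∀ c : Quad,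
    N ≤ (matrixOf c).1 ∨ N ≤ (matrixOf c).2.1 ∨ N ≤ (matrixOf c).2.2.1 ∨
      N ≤ (matrixOf c).2.2.2 → e.value c = M.top := by
  obtain ⟨n₁, h₁⟩ := M.exists_nsmul _ e.ha₀
  obtain ⟨n₂, h₂⟩ := M.exists_nsmul _ e.ha₁
  obtain ⟨n₃, h₃⟩ := M.exists_nsmul _ e.hb₀
  obtain ⟨n₄, h₄⟩ := M.exists_nsmul _ e.hb₁
  -- A matrix entry is the sum of one row and one column coefficient, so one of them is at least
  -- half of it.
  refine ⟨2 * (n₁ + n₂ + n₃ + n₄), fun c hc => ?_⟩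
  simp only [matrixOf, AddMonoidHom.coe_mk, ZeroHom.coe_mk] at hc
  rw [value_apply]
  have : n₁ ≤ c.1 ∨ n₂ ≤ c.2.1 ∨ n₃ ≤ c.2.2.1 ∨ n₄ ≤ c.2.2.2 := by omega
  rcases this with h | h | h | h
  · simp only [M.nsmul_eq_top_of_le h₁ h, M.top_add]
  · simp only [M.nsmul_eq_top_of_le h₂ h, M.top_add, M.add_top]
  · simp only [M.nsmul_eq_top_of_le h₃ h, M.top_add, M.add_top]
  · simp only [M.nsmul_eq_top_of_le h₄ h, M.add_top]

end Equation

variable (M : AbsorbingMonoid)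

/-- `matrixOf` in every component. -/
noncomputable def matrices : (M.Equation →₀ Quad) →+ (M.Equation →₀ Quad) :=
  Finsupp.mapRange.addMonoidHom matrixOf

/-- The sum of the values of all components. -/
noncomputable def totalValue : (M.Equation →₀ Quad) →+ M.carrier :=
  Finsupp.liftAddHom fun e => e.value

theorem matrices_apply (c : M.Equation →₀ Quad) (e : M.Equation) :
    M.matrices c e = matrixOf (c e) := by
  simp [matrices]

theorem totalValue_single (e : M.Equation) (c : Quad) :
    M.totalValue (Finsupp.single e c) = e.value c := by
  simp [totalValue]

theorem totalValue_eq_add (c : M.Equation →₀ Quad) (e : M.Equation) :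
    M.totalValue c = e.value (c e) + M.totalValue (c.erase e) := by
  conv_lhs => rw [← Finsupp.single_add_erase e c]
  rw [map_add, totalValue_single]

theorem totalValue_congr {c c' : M.Equation →₀ Quad} (h : M.matrices c = M.matrices c') :
    M.totalValue c = M.totalValue c' := by
  classical
  have key : ∀ c : M.Equation →₀ Quad, ∀ s : Finset M.Equation, c.support ⊆ s →
      M.totalValue c = ∑ e ∈ s, e.value (c e) := fun c s hs => by
    rw [totalValue, Finsupp.liftAddHom_apply]
    exact Finsupp.sum_of_support_subset c hs _ fun e _ => map_zero _
  rw [key c _ Finset.subset_union_left, key c' _ Finset.subset_union_right]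
  refine Finset.sum_congr rfl fun e _ => e.value_congr ?_
  rw [← matrices_apply, h, matrices_apply]

theorem totalValue_eq_zero {c : M.Equation →₀ Quad} (h : M.totalValue c = 0) : c = 0 := by
  ext1 e
  rw [M.totalValue_eq_add c e] at h
  exact e.value_eq_zero (M.conical _ _ h).1

theorem mem_range_matrices (f : M.Equation →₀ Quad) :
    (∃ c, M.matrices c = f) ↔ ∀ e, ∃ c, matrixOf c = f e := by
  classical
  constructor
  · rintro ⟨c, rfl⟩ e
    exact ⟨c e, (M.matrices_apply c e).symm⟩
  · intro h
    choose g hg using h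
    -- Choosing 0 where `f e = 0` keeps the support finite.
    refine ⟨Finsupp.onFinset f.support (fun e => if f e = 0 then 0 else g e) ?_, ?_⟩
    · intro e he
      rw [Finsupp.mem_support_iff]
      intro h0
      simp [h0] at he
    · ext1 e
      rw [matrices_apply, Finsupp.onFinset_apply]
      split_ifs with h0
      · rw [h0, map_zero]
      · exact hg e

/-- The range is cut out by linear equations over ℕ, and these can be cancelled. -/
theorem mem_range_of_add {f c : M.Equation →₀ Quad} (h : ∃ d, M.matrices d = f + M.matrices c) :
    ∃ d, M.matrices d = f := by
  rw [mem_range_matrices] at h ⊢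
  intro e
  have h₁ := (mem_range_matrixOf _).1 (h e)
  have h₂ := (mem_range_matrixOf _).1 ⟨c e, rfl⟩
  refine (mem_range_matrixOf _).2 ?_
  simp only [Finsupp.add_apply, matrices_apply, Prod.fst_add, Prod.snd_add] at h₁
  omega

/-! ### The valuation and its syntactic quotient -/

open Classical in
/-- `m + f` evaluated in `M` if the matrices `f` are combinations of full rows and columns, and
`top` otherwise. -/
noncomputable def evaluate (x : M.carrier × (M.Equation →₀ Quad)) : M.carrier :=
  if h : ∃ c, M.matrices c = x.2 then x.1 + M.totalValue h.choose else M.top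

theorem evaluate_matrices (m : M.carrier) (c : M.Equation →₀ Quad) :
    M.evaluate (m, M.matrices c) = m + M.totalValue c := by
  have h : ∃ d, M.matrices d = (m, M.matrices c).2 := ⟨c, rfl⟩
  rw [evaluate, dif_pos h, M.totalValue_congr h.choose_spec]

theorem evaluate_of_not_mem {x : M.carrier × (M.Equation →₀ Quad)}
    (h : ¬ ∃ c, M.matrices c = x.2) : M.evaluate x = M.top := by
  rw [evaluate, dif_neg h]

theorem evaluate_zero_right (m : M.carrier) : M.evaluate (m, 0) = m := by
  have := M.evaluate_matrices m 0
  rwa [map_zero, map_zero, add_zero] at this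

theorem evaluate_top (f : M.Equation →₀ Quad) : M.evaluate (M.top, f) = M.top := by
  by_cases h : ∃ c, M.matrices c = f
  · obtain ⟨c, rfl⟩ := h
    rw [evaluate_matrices, M.top_add]
  · exact M.evaluate_of_not_mem h

/-- This identifies rows and columns with their values in the quotient. When the matrices of `x` lie
outside the range, adding a range element keeps them outside, so both sides are `top`. -/
theorem evaluate_add (x : M.carrier × (M.Equation →₀ Quad)) (c : M.Equation →₀ Quad) :
    M.evaluate ((0, M.matrices c) + x) = M.evaluate ((M.totalValue c, 0) + x) := by
  obtain ⟨m, f⟩ := x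
  simp only [Prod.mk_add_mk, zero_add]
  by_cases h : ∃ d, M.matrices d = f
  · obtain ⟨d, rfl⟩ := h
    rw [← map_add, evaluate_matrices, evaluate_matrices, map_add]
    abel
  · rw [M.evaluate_of_not_mem (x := (_, f)) h, M.evaluate_of_not_mem]
    simp only
    rw [add_comm]
    exact fun h' => h (M.mem_range_of_add h')

/-- A non-zero matrix entry becomes at least `N` whatever `w` adds, so the valuation is `top` both
inside the range and outside it. -/
theorem evaluate_nsmul {x : M.carrier × (M.Equation →₀ Quad)} (hx : x ≠ 0) :
    ∃ n : ℕ, ∀ w, M.evaluate (n • x + w) = M.top := by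
  obtain ⟨m, f⟩ := x
  by_cases hm : m = 0
  · have hf : ∃ e, f e ≠ 0 := by
      by_contra! h
      exact hx (Prod.ext hm (Finsupp.ext h))
    obtain ⟨e, he⟩ := hf
    obtain ⟨N, hN⟩ := e.exists_value_eq_top
    refine ⟨N, ?_⟩
    rintro ⟨m', g⟩
    by_cases h : ∃ c, M.matrices c = N • f + g
    · obtain ⟨c, hc⟩ := h
      simp only [Prod.smul_mk, Prod.mk_add_mk]
      rw [← hc, evaluate_matrices, M.totalValue_eq_add c e, hN, M.top_add, M.add_top]
      rw [← matrices_apply, hc]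
      simp only [Finsupp.add_apply, Finsupp.smul_apply, Prod.fst_add, Prod.snd_add, Prod.smul_fst,
        Prod.smul_snd, smul_eq_mul]
      have : 1 ≤ (f e).1 ∨ 1 ≤ (f e).2.1 ∨ 1 ≤ (f e).2.2.1 ∨ 1 ≤ (f e).2.2.2 := by
        by_contra! h
        refine he (Prod.ext ?_ (Prod.ext ?_ (Prod.ext ?_ ?_))) <;>
          simp only [Prod.fst_zero, Prod.snd_zero] <;> omega
      have mul : ∀ k l : ℕ, 1 ≤ k → N ≤ N * k + l := fun k l hk =>
        (Nat.le_mul_of_pos_right N hk).trans (Nat.le_add_right _ _)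
      rcases this with h | h | h | h
      · exact Or.inl (mul _ _ h)
      · exact Or.inr (Or.inl (mul _ _ h))
      · exact Or.inr (Or.inr (Or.inl (mul _ _ h)))
      · exact Or.inr (Or.inr (Or.inr (mul _ _ h)))
    · exact M.evaluate_of_not_mem h
  · obtain ⟨n, hn⟩ := M.exists_nsmul m hm
    refine ⟨n, ?_⟩
    rintro ⟨m', g⟩
    simp only [Prod.smul_mk, Prod.mk_add_mk]
    rw [hn, M.top_add, evaluate_top]

theorem evaluate_add_eq_zero {x y : M.carrier × (M.Equation →₀ Quad)}
    (h : M.evaluate (x + y) = 0) : x = 0 ∧ y = 0 := by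
  obtain ⟨m, f⟩ := x
  obtain ⟨m', g⟩ := y
  rw [Prod.mk_add_mk] at h
  by_cases hr : ∃ c, M.matrices c = f + g
  · obtain ⟨c, hc⟩ := hr
    rw [← hc, evaluate_matrices] at h
    obtain ⟨h₁, h₂⟩ := M.conical _ _ h
    obtain ⟨rfl, rfl⟩ := M.conical _ _ h₁
    obtain rfl := M.totalValue_eq_zero h₂
    rw [map_zero] at hc
    have key : ∀ e, f e = 0 ∧ g e = 0 := fun e => by
      have := DFunLike.congr_fun hc e
      simp only [Finsupp.coe_zero, Pi.zero_apply, Finsupp.add_apply, Prod.ext_iff, Prod.fst_zero,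
        Prod.snd_zero, Prod.fst_add, Prod.snd_add] at this ⊢
      omega
    exact ⟨Prod.ext rfl (Finsupp.ext fun e => (key e).1),
      Prod.ext rfl (Finsupp.ext fun e => (key e).2)⟩
  · rw [M.evaluate_of_not_mem hr] at h
    exact absurd h M.top_ne

/-- The extension of `M` by refinements of all equations between non-zero elements. -/
noncomputable def extension : AbsorbingMonoid :=
  ofMap M.evaluate (M.top, 0)
    (by
      rw [evaluate_zero_right, ← Prod.mk_zero_zero, evaluate_zero_right]
      exact M.top_ne)
    (by
      rintro ⟨m, f⟩
      rw [Prod.mk_add_mk, M.top_add, evaluate_top, evaluate_top])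
    (fun x y h => M.evaluate_add_eq_zero (by
      rwa [← Prod.mk_zero_zero, evaluate_zero_right] at h))
    (fun x hx => by
      rw [evaluate_top]
      exact M.evaluate_nsmul hx)

/-- The class of an element in the extension. -/
noncomputable def toExtension : M.carrier × (M.Equation →₀ Quad) →+ M.extension.carrier :=
  (syntacticCon M.evaluate).mk'

/-- The inclusion of `M` in its extension. -/
noncomputable def incl : M.carrier →+ M.extension.carrier :=
  M.toExtension.comp (AddMonoidHom.inl _ _)

/-- The valuation restricts to the identity on M, so the zero translate already separates elements.
-/
theorem incl_injective : Function.Injective M.incl := by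
  intro x y h
  have := (AddCon.eq _).1 h 0
  simpa [evaluate_zero_right] using this

theorem toExtension_matrices (c : M.Equation →₀ Quad) :
    M.toExtension (0, M.matrices c) = M.incl (M.totalValue c) :=
  (AddCon.eq _).2 fun w => M.evaluate_add w c

theorem exists_refinement_incl (a₁ a₂ b₁ b₂ : M.carrier) (h : a₁ + a₂ = b₁ + b₂) :
    ∃ z₁₁ z₁₂ z₂₁ z₂₂ : M.extension.carrier,
      M.incl a₁ = z₁₁ + z₂₁ ∧ M.incl a₂ = z₁₂ + z₂₂ ∧
      M.incl b₁ = z₁₁ + z₁₂ ∧ M.incl b₂ = z₂₁ + z₂₂ := by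
  -- Equations with a zero term have obvious refinements; `Equation` omits them because a zero row
  -- or column would have no multiple equal to `top`.
  by_cases ha₁ : a₁ = 0
  · refine ⟨0, M.incl b₁, 0, M.incl b₂, ?_, ?_, ?_, ?_⟩
    · simp [ha₁]
    · rw [← map_add, ← h, ha₁, zero_add]
    · simp
    · simp
  by_cases ha₂ : a₂ = 0
  · refine ⟨M.incl b₁, 0, M.incl b₂, 0, ?_, ?_, ?_, ?_⟩
    · rw [← map_add, ← h, ha₂, add_zero]
    · simp [ha₂]
    · simp
    · simp
  by_cases hb₁ : b₁ = 0
  · refine ⟨0, 0, M.incl a₁, M.incl a₂, ?_, ?_, ?_, ?_⟩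
    · simp
    · simp
    · simp [hb₁]
    · rw [← map_add, h, hb₁, zero_add]
  by_cases hb₂ : b₂ = 0
  · refine ⟨M.incl a₁, M.incl a₂, 0, 0, ?_, ?_, ?_, ?_⟩
    · simp
    · simp
    · rw [← map_add, h, hb₂, add_zero]
    · simp [hb₂]
  let e : M.Equation := ⟨a₁, a₂, b₁, b₂, h, ha₁, ha₂, hb₁, hb₂⟩
  let z : Quad → M.extension.carrier := fun c => M.toExtension (0, Finsupp.single e c)
  have key : ∀ c x y, matrixOf c = x + y → M.incl (e.value c) = z x + z y := by
    intro c x y hc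
    rw [← totalValue_single, ← toExtension_matrices, ← map_add, Prod.mk_add_mk, zero_add,
      ← Finsupp.single_add, ← hc, matrices, Finsupp.mapRange.addMonoidHom_apply,
      Finsupp.mapRange_single]
  -- The middle entries are swapped: the aᵢ are rows in `Quad` but column sums in the required
  -- indexing.
  refine ⟨z (1, 0, 0, 0), z (0, 0, 1, 0), z (0, 1, 0, 0), z (0, 0, 0, 1), ?_, ?_, ?_, ?_⟩
  · rw [← key (1, 0, 0, 0) _ _ rfl]
    simp [Equation.value_apply, e]
  · rw [← key (0, 1, 0, 0) _ _ rfl]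
    simp [Equation.value_apply, e]
  · rw [← key (0, 0, 1, 0) _ _ rfl]
    simp [Equation.value_apply, e]
  · rw [← key (0, 0, 0, 1) _ _ rfl]
    simp [Equation.value_apply, e]

/-! ### The base monoid -/

/-- A finite multiset if it has no repetition, and a further value otherwise. -/
def nodupPart (s : Multiset ℕ) : Option (Multiset ℕ) := if s.Nodup then some s else none

theorem nodupPart_of_not {s : Multiset ℕ} (h : ¬ s.Nodup) : nodupPart s = none := if_neg h

theorem nodupPart_of_nodup {s : Multiset ℕ} (h : s.Nodup) : nodupPart s = some s := if_pos h

theorem nodupPart_add_self {s : Multiset ℕ} (hs : s ≠ 0) (w : Multiset ℕ) :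
    nodupPart (2 • s + w) = none := by
  refine nodupPart_of_not fun h => ?_
  obtain ⟨i, hi⟩ := Multiset.exists_mem_of_ne_zero hs
  have h₁ := Multiset.nodup_iff_count_le_one.1 h i
  have h₂ := Multiset.one_le_count_iff_mem.2 hi
  rw [Multiset.count_add, Multiset.count_nsmul] at h₁
  omega

/-- The finite subsets of `ℕ` under disjoint union, with an absorbing element for the sums that are
not disjoint. -/
def base : AbsorbingMonoid :=
  ofMap nodupPart (2 • {0})
    (by
      have := nodupPart_add_self (s := {0}) (by simp) 0
      rw [add_zero] at this
      rw [this, nodupPart_of_nodup Multiset.nodup_zero]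
      simp)
    (fun w => by
      have := nodupPart_add_self (s := {0}) (by simp) 0
      rw [add_zero] at this
      rw [this, nodupPart_add_self (by simp)])
    (fun x y h => by
      rw [nodupPart_of_nodup Multiset.nodup_zero, nodupPart] at h
      split_ifs at h
      exact add_eq_zero.1 (Option.some.inj h))
    (fun x hx => ⟨2, fun w => by
      have := nodupPart_add_self (s := {0}) (by simp) 0
      rw [add_zero] at this
      rw [this, nodupPart_add_self hx]⟩)

/-- The class of a multiset in the base monoid. -/
def toBase : Multiset ℕ →+ base.carrier := (syntacticCon nodupPart).mk'

theorem two_nsmul_toBase (n : ℕ) : 2 • toBase {n} = base.top := by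
  rw [← map_nsmul]
  refine (AddCon.eq _).2 fun w => ?_
  rw [nodupPart_add_self (by simp), nodupPart_add_self (by simp)]

theorem toBase_range_ne_top (k : ℕ) : toBase (Multiset.range k) ≠ base.top := by
  intro h
  have := (AddCon.eq _).1 h 0
  rw [nodupPart_add_self (by simp), add_zero,
    nodupPart_of_nodup (Multiset.nodup_range k)] at this
  simp at this

theorem sum_toBase (k : ℕ) : ∑ i ∈ Finset.range k, toBase {i} = toBase (Multiset.range k) := by
  rw [← map_sum]
  congr 1
  induction k with
  | zero => rfl
  | succ k ih => rw [Finset.sum_range_succ, ih, Multiset.range_succ, add_comm,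
      Multiset.singleton_add]

/-! ### The limit of the iterated extensions -/

/-- The iterated extensions of the base monoid. -/
noncomputable def stage : ℕ → AbsorbingMonoid
  | 0 => base
  | k + 1 => (stage k).extension

/-- The inclusion of a stage in the next. -/
noncomputable def stageIncl (k : ℕ) : (stage k).carrier →+ (stage (k + 1)).carrier :=
  (stage k).incl

open Filter

/-- The sequences that eventually follow the inclusions. -/
def coherent : AddSubmonoid (∀ k, (stage k).carrier) where
  carrier := {x | ∀ᶠ k in atTop, x (k + 1) = stageIncl k (x k)}
  zero_mem' := Eventually.of_forall fun k => (map_zero (stageIncl k)).symm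
  add_mem' := by
    intro x y hx hy
    filter_upwards [hx, hy] with k h h'
    rw [Pi.add_apply, Pi.add_apply, map_add, h, h']

/-- Eventual equality of coherent sequences. -/
def eventualCon : AddCon coherent where
  r x y := ∀ᶠ k in atTop, x.1 k = y.1 k
  iseqv := ⟨fun _ => Eventually.of_forall fun _ => rfl, fun h => h.mono fun _ h => h.symm,
    fun h h' => by filter_upwards [h, h'] with k e e' using e.trans e'⟩
  add' := by
    intro x y x' y' h h'
    filter_upwards [h, h'] with k e e'
    simp only [AddSubmonoid.coe_add, Pi.add_apply, e, e']

theorem eq_of_coherent {x y : ∀ k, (stage k).carrier} {K : ℕ}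
    (hx : ∀ k ≥ K, x (k + 1) = stageIncl k (x k)) (hy : ∀ k ≥ K, y (k + 1) = stageIncl k (y k))
    (h : x K = y K) : ∀ k ≥ K, x k = y k := by
  intro k hk
  induction k, hk using Nat.le_induction with
  | base => exact h
  | succ k hk ih => rw [hx k hk, hy k hk, ih]

/-- The sequence of images of an element of stage `K`. -/
noncomputable def follow {K : ℕ} (x : (stage K).carrier) (n : ℕ) : (stage n).carrier :=
  -- The value 0 before stage `K` is immaterial, as only eventual values count.
  if h : K ≤ n then Nat.leRecOn h (fun {k} => stageIncl k) x else 0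

theorem follow_self {K : ℕ} (x : (stage K).carrier) : follow x K = x := by
  rw [follow, dif_pos le_rfl, Nat.leRecOn_self]

theorem follow_succ {K : ℕ} (x : (stage K).carrier) {k : ℕ} (hk : K ≤ k) :
    follow x (k + 1) = stageIncl k (follow x k) := by
  rw [follow, dif_pos (Nat.le_succ_of_le hk), follow, dif_pos hk, Nat.leRecOn_succ hk]

theorem follow_mem {K : ℕ} (x : (stage K).carrier) : follow x ∈ coherent :=
  eventually_atTop.2 ⟨K, fun _ hk => follow_succ x hk⟩

/-- The constant sequence `top`. -/
noncomputable def topSeq : coherent := ⟨fun k => (stage k).top, Eventually.of_forall fun _ => rfl⟩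

/-- The limit of the stages. -/
noncomputable def limit : AbsorbingMonoid where
  carrier := eventualCon.Quotient
  top := (topSeq : eventualCon.Quotient)
  top_ne := by
    intro h
    obtain ⟨k, hk⟩ := ((AddCon.eq _).1 h).exists
    exact (stage k).top_ne hk
  top_add := by
    intro x
    induction x using AddCon.induction_on with
    | H x =>
      rw [← AddCon.coe_add]
      exact (AddCon.eq _).2 (Eventually.of_forall fun k => (stage k).top_add _)
  conical := by
    intro x y h
    induction x using AddCon.induction_on with
    | H x =>
    induction y using AddCon.induction_on with
    | H y =>
      rw [← AddCon.coe_add] at h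
      have h := (AddCon.eq _).1 h
      exact ⟨(AddCon.eq _).2 (h.mono fun k hk => ((stage k).conical _ _ hk).1),
        (AddCon.eq _).2 (h.mono fun k hk => ((stage k).conical _ _ hk).2)⟩
  exists_nsmul := by
    intro x hx
    induction x using AddCon.induction_on with
    | H x =>
      obtain ⟨K, hK⟩ := eventually_atTop.1 x.2
      have : ∃ k ≥ K, x.1 k ≠ 0 := by
        by_contra! h
        exact hx ((AddCon.eq _).2 (eventually_atTop.2 ⟨K, h⟩))
      obtain ⟨k, hk, hxk⟩ := this
      obtain ⟨n, hn⟩ := (stage k).exists_nsmul _ hxk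
      refine ⟨n, ?_⟩
      refine (map_nsmul eventualCon.mk' n x).symm.trans
        ((AddCon.eq _).2 (eventually_atTop.2 ⟨k, ?_⟩))
      -- `topSeq` is coherent by definition, since the `top` of an extension is the class of
      -- `(M.top, 0)`.
      refine eq_of_coherent (x := fun j => n • x.1 j) (y := topSeq.1) ?_ (fun _ _ => rfl) hn
      intro j hj
      rw [hK j (hk.trans hj), map_nsmul]

/-- An equation in the limit already holds at some stage `K`, and stage `K + 1` refines it. -/
theorem limit_refinement : RefMonoid.IsRefinement limit.carrier := by
  intro a₁ a₂ b₁ b₂ h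
  induction a₁ using AddCon.induction_on with
  | H a₁ =>
  induction a₂ using AddCon.induction_on with
  | H a₂ =>
  induction b₁ using AddCon.induction_on with
  | H b₁ =>
  induction b₂ using AddCon.induction_on with
  | H b₂ =>
    have h : ∀ᶠ k in atTop, a₁.1 k + a₂.1 k = b₁.1 k + b₂.1 k := (AddCon.eq _).1 h
    obtain ⟨K, hK⟩ := eventually_atTop.1
      (h.and (Eventually.and a₁.2 (Eventually.and a₂.2 (Eventually.and b₁.2 b₂.2))))
    obtain ⟨z₁₁, z₁₂, z₂₁, z₂₂, h₁, h₂, h₃, h₄⟩ :=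
      (stage K).exists_refinement_incl _ _ _ _ (hK K le_rfl).1
    let F : (stage (K + 1)).carrier → eventualCon.Quotient := fun z =>
      ((⟨follow z, follow_mem z⟩ : coherent) : eventualCon.Quotient)
    have key : ∀ (c : coherent) (z w : (stage (K + 1)).carrier),
        (∀ k ≥ K, c.1 (k + 1) = stageIncl k (c.1 k)) → (stage K).incl (c.1 K) = z + w →
        (c : eventualCon.Quotient) = F z + F w := by
      intro c z w hc hzw
      refine (AddCon.eq _).2 (eventually_atTop.2 ⟨K + 1, ?_⟩)
      refine eq_of_coherent (y := fun j => follow z j + follow w j)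
        (fun k hk => hc k (by omega)) ?_ ?_
      · intro k hk
        rw [follow_succ z hk, follow_succ w hk, map_add]
      · rw [follow_self, follow_self, hc K le_rfl]
        exact hzw
    exact ⟨F z₁₁, F z₁₂, F z₂₁, F z₂₂, key _ _ _ (fun k hk => (hK k hk).2.1) h₁,
      key _ _ _ (fun k hk => (hK k hk).2.2.1) h₂, key _ _ _ (fun k hk => (hK k hk).2.2.2.1) h₃,
      key _ _ _ (fun k hk => (hK k hk).2.2.2.2) h₄⟩

theorem follow_map_add (x y : (stage 0).carrier) :
    follow (x + y) = follow x + follow y := by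
  funext k
  refine eq_of_coherent (K := 0) (fun k hk => follow_succ _ hk) (fun k hk => ?_) ?_ k (Nat.zero_le k)
  · rw [Pi.add_apply, Pi.add_apply, follow_succ _ hk, follow_succ _ hk, map_add]
  · rw [Pi.add_apply, follow_self, follow_self, follow_self]

theorem follow_map_zero : follow (0 : (stage 0).carrier) = 0 := by
  funext k
  refine eq_of_coherent (K := 0) (fun k hk => follow_succ _ hk) (fun k hk => ?_) ?_ k (Nat.zero_le k)
  · rw [Pi.zero_apply, Pi.zero_apply, map_zero]
  · exact follow_self _

/-- The canonical map of the first stage to the limit. -/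
noncomputable def stageZeroToLimit : (stage 0).carrier →+ limit.carrier :=
  eventualCon.mk'.comp
    { toFun := fun x => ⟨follow x, follow_mem _⟩
      map_zero' := Subtype.ext follow_map_zero
      map_add' := fun x y => Subtype.ext (follow_map_add x y) }

theorem follow_injective {x y : (stage 0).carrier} {k : ℕ}
    (h : follow x k = follow y k) : x = y := by
  induction k with
  | zero => rwa [follow_self, follow_self] at h
  | succ k ih =>
    rw [follow_succ _ (Nat.zero_le k), follow_succ _ (Nat.zero_le k)] at h
    exact ih ((stage k).incl_injective h)

theorem stageZeroToLimit_injective : Function.Injective stageZeroToLimit := by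
  intro x y h
  obtain ⟨k, hk⟩ := ((AddCon.eq _).1 h).exists
  exact follow_injective hk

theorem stageZeroToLimit_top : stageZeroToLimit (stage 0).top = limit.top := by
  refine (AddCon.eq _).2 (eventually_atTop.2 ⟨0, ?_⟩)
  exact eq_of_coherent (x := follow (stage 0).top) (y := topSeq.1) (fun k hk => follow_succ _ hk)
    (fun _ _ => rfl) (follow_self _)

/-- The canonical map of the base monoid to the limit. -/
noncomputable def toLimit : base.carrier →+ limit.carrier := stageZeroToLimit

theorem toLimit_injective : Function.Injective toLimit := stageZeroToLimit_injective

theorem toLimit_top : toLimit base.top = limit.top := stageZeroToLimit_top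

/-! ### Consequences for absorbing monoids -/

theorem le_top (x : M.carrier) : RefMonoid.AlgLE x M.top := ⟨M.top, M.add_top x⟩

theorem simple : RefMonoid.IsSimple M.carrier := by
  intro u hu
  refine ⟨hu, fun x => ?_⟩
  obtain ⟨n, hn⟩ := M.exists_nsmul u hu
  exact ⟨n, hn ▸ M.le_top x⟩

/-- If u absorbs y then it absorbs every multiple of y, and one of these is `top`. -/
theorem eq_top_of_infinite {u : M.carrier} (h : RefMonoid.IsInfinite u) : u = M.top := by
  obtain ⟨-, y, hy, h⟩ := h
  have key : ∀ n : ℕ, u = u + n • y := by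
    intro n
    induction n with
    | zero => rw [zero_nsmul, add_zero]
    | succ n ih => rw [succ_nsmul, ← add_assoc, ← ih, ← h]
  obtain ⟨n, hn⟩ := M.exists_nsmul y hy
  rw [key n, hn, M.add_top]

theorem properlyInfinite_top : RefMonoid.IsProperlyInfinite M.top :=
  ⟨M.top_ne, M.le_top _⟩

theorem eq_top_of_top_le {x : M.carrier} (h : RefMonoid.AlgLE M.top x) : x = M.top := by
  obtain ⟨z, hz⟩ := h
  rw [← hz, M.top_add]

/-- The constant sequence `top` is full and lies below every 2yₙ, but only `top` lies above `top`.
-/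
theorem not_hasCFP (y : ℕ → M.carrier) (hy : ∀ n, 2 • y n = M.top)
    (hsum : ∀ k, ∑ i ∈ Finset.range k, y i ≠ M.top) : ¬ RefMonoid.HasCFP M.carrier := by
  intro h
  obtain ⟨k, hk⟩ := h (fun _ => M.top) y
    ⟨fun _ => M.le_top _, fun x => ⟨0, 1, by rw [one_nsmul]; exact M.le_top x⟩⟩ 2
    (fun n => by rw [hy]; exact M.le_top _)
  exact hsum _ (M.eq_top_of_top_le hk)

end AbsorbingMonoid

theorem mainTheorem10 :
    ∃ (M : Type) (_ : AddCommMonoid M),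
      RefMonoid.IsSimple M ∧ RefMonoid.IsConical M ∧ RefMonoid.IsRefinement M ∧
      (∃ u : M, RefMonoid.IsOrderUnit u ∧ ¬ RefMonoid.IsInfinite u ∧
        RefMonoid.IsProperlyInfinite (2 • u)) ∧
      ¬ RefMonoid.HasCFP M := by
  let y : ℕ → AbsorbingMonoid.limit.carrier :=
    fun n => AbsorbingMonoid.toLimit (AbsorbingMonoid.toBase {n})
  have hy : ∀ n, 2 • y n = AbsorbingMonoid.limit.top := fun n => by
    rw [← map_nsmul, AbsorbingMonoid.two_nsmul_toBase, AbsorbingMonoid.toLimit_top]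
  have hsum : ∀ k, ∑ i ∈ Finset.range k, y i ≠ AbsorbingMonoid.limit.top := fun k h => by
    rw [← map_sum, AbsorbingMonoid.sum_toBase, ← AbsorbingMonoid.toLimit_top] at h
    exact AbsorbingMonoid.toBase_range_ne_top k (AbsorbingMonoid.toLimit_injective h)
  have hy₀ : y 0 ≠ 0 := fun h => AbsorbingMonoid.limit.top_ne (by rw [← hy 0, h, nsmul_zero])
  refine ⟨AbsorbingMonoid.limit.carrier, inferInstance, AbsorbingMonoid.limit.simple,
    AbsorbingMonoid.limit.conical, AbsorbingMonoid.limit_refinement,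
    ⟨y 0, AbsorbingMonoid.limit.simple _ hy₀, fun h => ?_, ?_⟩,
    AbsorbingMonoid.limit.not_hasCFP y hy hsum⟩
  · have := hsum 1
    rw [Finset.sum_range_one] at this
    exact this (AbsorbingMonoid.limit.eq_top_of_infinite h)
  · rw [hy]
    exact AbsorbingMonoid.limit.properlyInfinite_top
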